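/- For a bounded nondegenerate interval $J\subset\mathbb{R}$ write $\langle f\rangle_J=\frac1{|J|}\int_J f$. For a bounded nondegenerate interval $Q$ let $\mathrm{BMO}(Q)$ be the set of real-valued $\varphi\in L^1(Q)$ for which $$\|\varphi\|_{\mathrm{BMO}(Q)}=\sup_{J\subset Q}\big\langle|\varphi-\langle\varphi\rangle_J|^2\big\rangle_J^{1/2}<\infty,$$ the supremum being over all nondegenerate subintervals $J$ of $Q$ (equivalently, $\|\varphi\|_{\mathrm{BMO}(Q)}^2=\sup_{J\subset Q}(\langle\varphi^2\rangle_J-\langle\varphi\rangle_J^2)$). There is a function $C\colon[0,1)\to\mathbb{R}$ such that for every bounded nondegenerate interval $Q$ and every $\varphi\in\mathrm{BMO}(Q)$ with $\|\varphi\|=\|\varphi\|_{\mathrm{BMO}(Q)}<1$, $$\big\langle e^{|\varphi-\langle\varphi\rangle_Q|}\big\rangle_Q\le C(\|\varphi\|).$$ For every $\varepsilon\in[0,1)$ there is a smallest such value: $C$ can be chosen so that, for every $Q$ and every $\varepsilon\in[0,1)$, $C(\varepsilon)$ is the smallest constant $K$ with $\langle e^{|\varphi-\langle\varphi\rangle_Q|}\rangle_Q\le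 K$ for all $\varphi\in\mathrm{BMO}(Q)$ with $\|\varphi\|_{\mathrm{BMO}(Q)}=\varepsilon$. This best constant satisfies $$\frac{1-\frac{\varepsilon}{2}}{1-\varepsilon}\le C(\varepsilon)\le\frac{1-\frac{\varepsilon^2}{2}}{1-\varepsilon}\qquad(0\le\varepsilon<1).$$ The bound $1$ on the norm is sharp: for every bounded nondegenerate interval $Q$ there is $\varphi\in\mathrm{BMO}(Q)$ with $\|\varphi\|_{\mathrm{BMO}(Q)}=1$ and $\langle e^{|\varphi-\langle\varphi\rangle_Q|}\rangle_Q=\infty$. -/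

import Mathlib

open MeasureTheory Set
open scoped ENNReal

/-- The mean square oscillation `⟨|φ - ⟨φ⟩_J|²⟩_J` of `φ` over a set `J` of finite positive length,
as an extended nonnegative number. For `φ` integrable on `J` it equals `⟨φ²⟩_J - ⟨φ⟩_J²`
if `φ²` is integrable on `J`, and `∞` otherwise. -/
noncomputable def sqOscillation (φ : ℝ → ℝ) (J : Set ℝ) : ℝ≥0∞ :=
  (∫⁻ t in J, ENNReal.ofReal ((φ t - ⨍ s in J, φ s) ^ 2)) / volume J

/-- The (quadratic) BMO norm of `φ` on the interval `Q`: the supremum of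
`⟨|φ - ⟨φ⟩_J|²⟩_J ^ (1/2)` over all nondegenerate subintervals `J = (c, d)` of `Q`. -/
noncomputable def bmoNorm (φ : ℝ → ℝ) (Q : Set ℝ) : ℝ≥0∞ :=
  ⨆ (c : ℝ) (d : ℝ) (_ : c < d) (_ : Ioo c d ⊆ Q), sqOscillation φ (Ioo c d) ^ (1 / 2 : ℝ)

/-- `φ ∈ BMO(Q)`: `φ ∈ L¹(Q)` and its BMO norm on `Q` is finite. -/
def MemBMO (φ : ℝ → ℝ) (Q : Set ℝ) : Prop :=
  IntegrableOn φ Q ∧ bmoNorm φ Q < ∞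

/-- The exponential average `⟨exp |φ - ⟨φ⟩_Q|⟩_Q`, with value `∞` if the exponential is not
integrable on `Q`. -/
noncomputable def expAverage (φ : ℝ → ℝ) (Q : Set ℝ) : ℝ≥0∞ :=
  (∫⁻ t in Q, ENNReal.ofReal (Real.exp |φ t - ⨍ s in Q, φ s|)) / volume Q

/-!
The upper bound rests on a reverse Hölder inequality. If `ψ ≥ 0` has mean square oscillation at most
`ε ^ 2` on every subinterval of `Q` and mean at most `ε` on `Q`, then `∫ ψ ^ 2 ≤ 2 * ε * ∫ ψ`
(`OscLE.integral_sq_le`): a rising sun argument (`integral_nonpos_of_rising_sun`) divides `Q` into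
intervals on which the mean of `ψ` is exactly `ε`, where the second moment is at most `2 * ε ^ 2`,
and a remainder where `ψ ≤ ε`. Let now `φ` have mean zero and norm `ε`. The inequality applies to
each truncation `max (φ - l) 0` with `l ≥ 0`, because `1`-Lipschitz maps do not increase the mean
square oscillation. Integrating it against `exp l` over `l` gives
`∫ (exp φ⁺ - 1 - φ⁺) ≤ (∫ (φ⁺) ^ 2) / (2 * (1 - ε))`, and likewise for `φ⁻`. Adding
`⟨|φ|⟩ ≤ ε` and `⟨φ ^ 2⟩ ≤ ε ^ 2` yields
`⟨exp |φ|⟩ ≤ 1 + ε + ε ^ 2 / (2 * (1 - ε)) = (1 - ε ^ 2 / 2) / (1 - ε)`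
(`expAverage_le_of_bmoNorm_le`). Bounded `φ` come first, so that all integrals are finite; the
general case follows by monotone convergence.

For the lower bound and for sharpness, let `φ` on `(0, 4)` be `ε * log (1 / t)` on `(0, 1)`, zero on
`(1, 3)`, and on `(3, 4)` the negative of the mirror image of the first piece (`doubleSpike`). Its
norm is `ε`, attained on the whole interval, and its exponential average is
`(1 - ε / 2) / (1 - ε)`, or infinite if `ε = 1`. Both the norm and the exponential average are
invariant under affine changes of variable (`exists_transplant`), so the supremum over one interval
is the best constant for every interval.
-/

/-! ### A rising sun principle with exact averages -/

/-- Every point of a bounded open set lies in a maximal open interval of that set. -/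
theorem exists_maximal_Ioo {E : Set ℝ} (hE : IsOpen E) {p b : ℝ} (hEs : E ⊆ Ioo p b) {x : ℝ}
    (hx : x ∈ E) : ∃ c d, c ∉ E ∧ d ∉ E ∧ x ∈ Ioo c d ∧ Ioo c d ⊆ E := by
  have hp : p ∉ E := fun h => lt_irrefl _ (hEs h).1
  have hb : b ∉ E := fun h => lt_irrefl _ (hEs h).2
  have hcl : IsClosed Eᶜ := hE.isClosed_compl
  have hA : sSup (Eᶜ ∩ Iic x) ∈ Eᶜ ∩ Iic x :=
    (hcl.inter isClosed_Iic).csSup_mem ⟨p, hp, (hEs hx).1.le⟩ ⟨x, fun y hy => hy.2⟩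
  have hB : sInf (Eᶜ ∩ Ici x) ∈ Eᶜ ∩ Ici x :=
    (hcl.inter isClosed_Ici).csInf_mem ⟨b, hb, (hEs hx).2.le⟩ ⟨x, fun y hy => hy.2⟩
  refine ⟨_, _, hA.1, hB.1, ⟨lt_of_le_of_ne hA.2 fun h => hA.1 (by rw [h]; exact hx),
    lt_of_le_of_ne hB.2 fun h => hB.1 (by rw [← h]; exact hx)⟩, fun y hy => ?_⟩
  by_contra hyE
  rcases le_total y x with h | h
  · exact absurd (le_csSup ⟨x, fun z hz => hz.2⟩ (⟨hyE, h⟩ : y ∈ Eᶜ ∩ Iic x)) (not_le.2 hy.1)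
  · exact absurd (csInf_le ⟨x, fun z hz => hz.2⟩ (⟨hyE, h⟩ : y ∈ Eᶜ ∩ Ici x)) (not_le.2 hy.2)

/-- If the integral of `h` over every maximal open subinterval of a bounded open set is nonpositive,
so is the integral over the whole set. -/
theorem setIntegral_nonpos_of_maximal_Ioo {E : Set ℝ} (hE : IsOpen E) {p b : ℝ}
    (hEs : E ⊆ Ioo p b) {h : ℝ → ℝ} (hh : IntegrableOn h E)
    (H : ∀ c d, c < d → c ∉ E → d ∉ E → Ioo c d ⊆ E → ∫ t in Ioo c d, h t ≤ 0) :
    ∫ t in E, h t ≤ 0 := by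
  let 𝒞 : Set (Set ℝ) := {s | ∃ c d, c < d ∧ c ∉ E ∧ d ∉ E ∧ Ioo c d ⊆ E ∧ s = Ioo c d}
  have hdisj : 𝒞.PairwiseDisjoint id := by
    rintro _ ⟨c, d, hcd, hc, hd, hs, rfl⟩ _ ⟨c', d', hcd', hc', hd', hs', rfl⟩ hne
    refine Set.disjoint_left.2 fun x hx hx' => hne ?_
    simp only [id] at hx hx'
    have h1 : c = c' := by
      rcases lt_trichotomy c c' with h | h | h
      · exact absurd (hs ⟨h, hx'.1.trans hx.2⟩) hc'
      · exact h
      · exact absurd (hs' ⟨h, hx.1.trans hx'.2⟩) hc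
    have h2 : d = d' := by
      rcases lt_trichotomy d d' with h | h | h
      · exact absurd (hs' ⟨hx'.1.trans hx.2, h⟩) hd
      · exact h
      · exact absurd (hs ⟨hx.1.trans hx'.2, h⟩) hd'
    rw [h1, h2]
  have hcount : 𝒞.Countable := by
    refine hdisj.countable_of_isOpen ?_ ?_
    · rintro _ ⟨c, d, -, -, -, -, rfl⟩
      exact isOpen_Ioo
    · rintro _ ⟨c, d, hcd, -, -, -, rfl⟩
      exact nonempty_Ioo.2 hcd
  have hU : E = ⋃ s : 𝒞, (s : Set ℝ) := by
    apply Subset.antisymm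
    · intro x hx
      obtain ⟨c, d, hc, hd, hx', hs⟩ := exists_maximal_Ioo hE hEs hx
      exact mem_iUnion.2 ⟨⟨Ioo c d, c, d, hx'.1.trans hx'.2, hc, hd, hs, rfl⟩, hx'⟩
    · refine iUnion_subset ?_
      rintro ⟨_, c, d, hcd, hc, hd, hs, rfl⟩
      exact hs
  have : Countable 𝒞 := hcount.to_subtype
  rw [hU, integral_iUnion]
  · refine tsum_nonpos ?_
    rintro ⟨_, c, d, hcd, hc, hd, hs, rfl⟩
    exact H c d hcd hc hd hs
  · rintro ⟨_, c, d, hcd, hc, hd, hs, rfl⟩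
    exact measurableSet_Ioo
  · intro s t hst
    exact hdisj s.2 t.2 fun h => hst (Subtype.ext h)
  · rwa [← hU]

/-- At almost every point from which the primitive of `u` never rises again, `u` is nonpositive. -/
theorem ae_nonpos_of_primitive_le {u : ℝ → ℝ} {a b : ℝ} (hab : a ≤ b)
    (hu : IntervalIntegrable u volume a b) :
    ∀ᵐ t, t ∈ Ioo a b → (∀ s ∈ Ioc t b, ∫ x in a..s, u x ≤ ∫ x in a..t, u x) → u t ≤ 0 := by
  filter_upwards [hu.ae_hasDerivAt_integral] with t ht htm hle
  have hd := ht (by rw [uIcc_of_le hab]; exact Ioo_subset_Icc_self htm) a left_mem_uIcc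
  have := hd.hasDerivWithinAt (s := Ioi t)
  rw [hasDerivWithinAt_iff_tendsto_slope' (by simp)] at this
  refine le_of_tendsto this ?_
  filter_upwards [Ioo_mem_nhdsGT htm.2] with s hs
  rw [slope_def_field]
  exact div_nonpos_of_nonpos_of_nonneg (sub_nonpos.2 (hle s ⟨hs.1, hs.2.le⟩)) (sub_pos.2 hs.1).le

/-- **Rising sun principle.** Let `u` have nonpositive integral over `(a, b)`. If `∫ h ≤ 0` over
each subinterval on which `u` has integral exactly zero, and `h ≤ 0` wherever `u ≤ 0`, then
`∫ h ≤ 0` over `(a, b)`. -/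
theorem integral_nonpos_of_rising_sun {u h : ℝ → ℝ} {a b : ℝ} (hab : a ≤ b)
    (hu : IntervalIntegrable u volume a b) (hh : IntervalIntegrable h volume a b)
    (hu0 : ∫ t in a..b, u t ≤ 0)
    (H : ∀ c d, a ≤ c → c < d → d ≤ b → ∫ t in c..d, u t = 0 → ∫ t in c..d, h t ≤ 0)
    (H' : ∀ t ∈ Ioo a b, u t ≤ 0 → h t ≤ 0) : ∫ t in a..b, h t ≤ 0 := by
  set F : ℝ → ℝ := fun t => ∫ x in a..t, u x with hF
  have hsub : ∀ {f : ℝ → ℝ}, IntervalIntegrable f volume a b → ∀ {c d}, a ≤ c → c ≤ d → d ≤ b →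
      IntervalIntegrable f volume c d := fun hf c d hc hcd hd =>
    hf.mono_set (by rw [uIcc_of_le hcd, uIcc_of_le hab]; exact Icc_subset_Icc hc hd)
  have hFc : ContinuousOn F (Icc a b) := by
    have := intervalIntegral.continuousOn_primitive_interval' hu left_mem_uIcc
    rwa [uIcc_of_le hab] at this
  have hFa : F a = 0 := by simp [hF]
  have hFsub : ∀ {c d}, a ≤ c → c ≤ d → d ≤ b → ∫ t in c..d, u t = F d - F c := by
    intro c d hc hcd hd
    rw [hF, intervalIntegral.integral_interval_sub_left] <;> apply hsub hu <;> linarith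
  -- `p` is the last point where the primitive is nonnegative; it vanishes there.
  let S : Set ℝ := Icc a b ∩ F ⁻¹' Ici 0
  have hScl : IsClosed S := hFc.preimage_isClosed_of_isClosed isClosed_Icc isClosed_Ici
  have hSbdd : BddAbove S := ⟨b, fun x hx => hx.1.2⟩
  have hpS : sSup S ∈ S := hScl.csSup_mem ⟨a, ⟨le_rfl, hab⟩, hFa.ge⟩ hSbdd
  have hlast : ∀ s ∈ Ioc (sSup S) b, F s < 0 := by
    intro s hs
    by_contra hcon
    exact absurd (le_csSup hSbdd (⟨⟨hpS.1.1.trans hs.1.le, hs.2⟩, not_lt.1 hcon⟩ : s ∈ S))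
      (not_le.2 hs.1)
  generalize sSup S = p at hpS hlast
  obtain ⟨⟨hap, hpb⟩, hFp⟩ := hpS
  have hFp : 0 ≤ F p := hFp
  have hFp0 : F p = 0 := by
    refine le_antisymm (not_lt.1 fun hpos => ?_) hFp
    have hsubI := intermediate_value_Icc' hpb (hFc.mono (Icc_subset_Icc_left hap))
    obtain ⟨s, hs, hs0⟩ := hsubI ⟨hu0, hpos.le⟩
    have : p < s := lt_of_le_of_ne hs.1 (by rintro rfl; linarith)
    linarith [hlast s ⟨this, hs.2⟩]
  have hfirst : ∫ t in a..p, h t ≤ 0 := by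
    rcases hap.eq_or_lt with rfl | hlt
    · simp
    · exact H a p le_rfl hlt hpb hFp0
  -- The points of `(p, b)` from which the primitive rises later on.
  let E : Set ℝ := Ioo p b ∩ ⋃ s ∈ Icc p b, Ioo p s ∩ F ⁻¹' Iio (F s)
  have hmemE : ∀ {t}, t ∈ E ↔ t ∈ Ioo p b ∧ ∃ s ∈ Ioc t b, F t < F s := by
    intro t
    simp only [E, mem_inter_iff, mem_iUnion, mem_preimage, mem_Iio, exists_prop]
    constructor
    · rintro ⟨ht, s, hs, hts, hlt⟩
      exact ⟨ht, s, ⟨hts.2, hs.2⟩, hlt⟩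
    · rintro ⟨ht, s, hs, hlt⟩
      exact ⟨ht, s, ⟨ht.1.le.trans hs.1.le, hs.2⟩, ⟨ht.1, hs.1⟩, hlt⟩
  have hEo : IsOpen E := by
    refine isOpen_Ioo.inter (isOpen_biUnion fun s hs => ?_)
    exact (hFc.mono (Ioo_subset_Icc_self.trans (Icc_subset_Icc hap hs.2))).isOpen_inter_preimage
      isOpen_Ioo isOpen_Iio
  have hEs : E ⊆ Ioo p b := inter_subset_left
  have hhp : IntegrableOn h (Ioo p b) :=
    ((intervalIntegrable_iff_integrableOn_Ioo_of_le hpb).1 (hsub hh hap hpb le_rfl))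
  have hEint : ∫ t in E, h t ≤ 0 := by
    refine setIntegral_nonpos_of_maximal_Ioo hEo hEs (hhp.mono_set hEs) ?_
    intro c d hcd hcE hdE hs
    have hcl : Icc c d ⊆ Icc p b := by
      rw [← closure_Ioo hcd.ne]
      exact closure_minimal (hs.trans (hEs.trans Ioo_subset_Icc_self)) isClosed_Icc
    have hpc : p ≤ c := (hcl ⟨le_rfl, hcd.le⟩).1
    have hdb : d ≤ b := (hcl ⟨hcd.le, le_rfl⟩).2
    -- A maximum point of the primitive on `[x, b]` lies outside `E`, hence in `[d, b]`, and the
    -- primitive does not rise above `F d` after `d`.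
    have hFcd : ∀ x ∈ Ioo c d, F x ≤ F d := by
      intro x hx
      have hxp : p ≤ x := hpc.trans hx.1.le
      have hxb : x ≤ b := hx.2.le.trans hdb
      obtain ⟨y, hy, hmax⟩ := isCompact_Icc.exists_isMaxOn (nonempty_Icc.2 hxb)
        (hFc.mono (Icc_subset_Icc_left (hap.trans hxp)))
      have hyE : y ∉ E := fun h => by
        obtain ⟨-, s, hs, hlt⟩ := hmemE.1 h
        exact absurd (hmax ⟨hy.1.trans hs.1.le, hs.2⟩) (not_le.2 hlt)
      have hdy : d ≤ y := by
        by_contra hcon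
        exact hyE (hs ⟨hx.1.trans_le hy.1, not_le.1 hcon⟩)
      have hyd : F y ≤ F d := by
        rcases hdy.eq_or_lt with h | h
        · rw [h]
        · by_contra hcon
          exact hdE (hmemE.2 ⟨⟨hpc.trans_lt hcd, h.trans_le hy.2⟩, y, ⟨h, hy.2⟩, not_le.1 hcon⟩)
      exact (hmax ⟨le_rfl, hxb⟩).trans hyd
    have hle : F c ≤ F d := by
      have hcts : ContinuousWithinAt F (Ioo c d) c :=
        (hFc c ⟨hap.trans hpc, hcd.le.trans hdb⟩).mono
          (Ioo_subset_Icc_self.trans (hcl.trans (Icc_subset_Icc_left hap)))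
      exact hcts.closure_le (by rw [closure_Ioo hcd.ne]; exact ⟨le_rfl, hcd.le⟩)
        continuousWithinAt_const hFcd
    -- If `c = p`, this holds because the primitive is negative after `p`; the choice of `p` makes
    -- the average exact also on a component of `E` that starts at the left end.
    have hge : F d ≤ F c := by
      rcases hpc.eq_or_lt with h | h
      · rw [← h, hFp0]
        exact (hlast d ⟨h.trans_lt hcd, hdb⟩).le
      · by_contra hcon
        exact hcE (hmemE.2 ⟨⟨h, hcd.trans_le hdb⟩, d, ⟨hcd, hdb⟩, not_le.1 hcon⟩)
    rw [← integral_Ioc_eq_integral_Ioo, ← intervalIntegral.integral_of_le hcd.le]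
    refine H c d (hap.trans hpc) hcd hdb ?_
    rw [hFsub (hap.trans hpc) hcd.le hdb, le_antisymm hge hle, sub_self]
  have hcompl : ∫ t in Ioo p b \ E, h t ≤ 0 := by
    refine setIntegral_nonpos_ae (measurableSet_Ioo.diff hEo.measurableSet) ?_
    filter_upwards [ae_nonpos_of_primitive_le hab hu] with t ht htm
    have htab : t ∈ Ioo a b := ⟨hap.trans_lt htm.1.1, htm.1.2⟩
    refine H' t htab (ht htab fun s hs => ?_)
    by_contra hcon
    exact htm.2 (hmemE.2 ⟨htm.1, s, hs, not_le.1 hcon⟩)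
  have hlastint : ∫ t in p..b, h t ≤ 0 := by
    rw [intervalIntegral.integral_of_le hpb, integral_Ioc_eq_integral_Ioo,
      ← inter_union_sdiff (Ioo p b) E, inter_eq_right.2 hEs, setIntegral_union disjoint_sdiff_right
      (measurableSet_Ioo.diff hEo.measurableSet) (hhp.mono_set hEs) (hhp.mono_set sdiff_subset)]
    linarith
  rw [← intervalIntegral.integral_add_adjacent_intervals (hsub hh le_rfl hap hpb)
    (hsub hh hap hpb le_rfl)]
  linarith

/-! ### Mean oscillation and truncation -/

/-- The mean square oscillation of `φ` over every subinterval of `(a, b)` is at most `ε ^ 2`.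
The oscillation is taken about an arbitrary constant, which is equivalent to taking it about the
mean and makes the condition visibly stable under `1`-Lipschitz maps. The integrals are Bochner
integrals, so the condition is meaningful for `φ` square integrable on `(a, b)`. -/
def OscLE (ε : ℝ) (φ : ℝ → ℝ) (a b : ℝ) : Prop :=
  ∀ c d, a ≤ c → c < d → d ≤ b → ∃ m, ∫ t in Ioo c d, (φ t - m) ^ 2 ≤ ε ^ 2 * (d - c)

theorem MeasureTheory.MemLp.lipschitz_comp {g φ : ℝ → ℝ} {μ : Measure ℝ} [IsFiniteMeasure μ]
    (hφ : MemLp φ 2 μ) (hg : LipschitzWith 1 g) : MemLp (fun t => g (φ t)) 2 μ := by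
  refine ((memLp_const |g 0|).add hφ.abs).mono'
    (hg.continuous.comp_aestronglyMeasurable hφ.1) (ae_of_all _ fun t => ?_)
  have := hg.dist_le_mul (φ t) 0
  simp only [Real.dist_eq, NNReal.coe_one, one_mul, sub_zero] at this
  rw [Real.norm_eq_abs, Pi.add_apply]
  calc |g (φ t)| = |g 0 + (g (φ t) - g 0)| := by ring_nf
    _ ≤ |g 0| + |g (φ t) - g 0| := abs_add_le _ _
    _ ≤ |g 0| + |φ t| := by gcongr

theorem MeasureTheory.MemLp.restrict_Ioo {φ : ℝ → ℝ} {a b c d : ℝ}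
    (hφ : MemLp φ 2 (volume.restrict (Ioo a b))) (hc : a ≤ c) (hd : d ≤ b) :
    MemLp φ 2 (volume.restrict (Ioo c d)) :=
  hφ.mono_measure (Measure.restrict_mono (Ioo_subset_Ioo hc hd) le_rfl)

theorem OscLE.lipschitz_comp {ε : ℝ} {g φ : ℝ → ℝ} {a b : ℝ} (h : OscLE ε φ a b)
    (hφ : MemLp φ 2 (volume.restrict (Ioo a b))) (hg : LipschitzWith 1 g) :
    OscLE ε (fun t => g (φ t)) a b := by
  intro c d hc hcd hd
  obtain ⟨m, hm⟩ := h c d hc hcd hd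
  have hφ' := hφ.restrict_Ioo hc hd
  refine ⟨g m, le_trans (integral_mono ((hφ'.lipschitz_comp hg).sub (memLp_const _)).integrable_sq
    (hφ'.sub (memLp_const m)).integrable_sq fun t => ?_) hm⟩
  have := hg.dist_le_mul (φ t) m
  simp only [Real.dist_eq, NNReal.coe_one, one_mul] at this
  exact sq_le_sq.2 this

theorem lipschitzWith_max_sub (l : ℝ) : LipschitzWith 1 fun x : ℝ => max (x - l) 0 :=
  LipschitzWith.of_dist_le_mul fun x y => by
    simpa [Real.dist_eq] using abs_max_sub_max_le_abs (x - l) (y - l) 0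

theorem lipschitzWith_clamp (N : ℝ) : LipschitzWith 1 fun x : ℝ => max (-N) (min x N) :=
  (LipschitzWith.id.min_const N).const_max (-N)

/-! ### The exponential estimate -/

/-- A reverse Hölder inequality for a nonnegative function of mean at most `ε` and oscillation at
most `ε`. On an interval where the mean equals `ε`, the second moment is at most `2 * ε ^ 2`; where
the function is at most `ε`, the inequality holds pointwise. The rising sun principle divides
`(a, b)` into such parts. -/
theorem OscLE.integral_sq_le {ε : ℝ} (hε : 0 ≤ ε) {ψ : ℝ → ℝ} {a b : ℝ} (hab : a ≤ b)
    (h : OscLE ε ψ a b) (hψ : MemLp ψ 2 (volume.restrict (Ioo a b))) (h0 : ∀ t, 0 ≤ ψ t)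
    (hmean : ∫ t in Ioo a b, ψ t ≤ ε * (b - a)) :
    ∫ t in Ioo a b, ψ t ^ 2 ≤ 2 * ε * ∫ t in Ioo a b, ψ t := by
  have key : ∫ t in a..b, (ψ t ^ 2 - 2 * ε * ψ t) ≤ 0 := by
    refine integral_nonpos_of_rising_sun (u := fun t => ψ t - ε) hab ?_ ?_ ?_ ?_ ?_
    · rw [intervalIntegrable_iff_integrableOn_Ioo_of_le hab]
      exact (hψ.integrable one_le_two).sub (integrable_const _)
    · rw [intervalIntegrable_iff_integrableOn_Ioo_of_le hab]
      exact hψ.integrable_sq.sub ((hψ.integrable one_le_two).const_mul _)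
    · rw [intervalIntegral.integral_of_le hab, integral_Ioc_eq_integral_Ioo,
        integral_sub (hψ.integrable one_le_two) (integrable_const _)]
      simp [hab]
      linarith
    · intro c d hc hcd hd hu
      obtain ⟨m, hm⟩ := h c d hc hcd hd
      have hψ' := hψ.restrict_Ioo hc hd
      have hui : Integrable (fun t => ψ t - ε) (volume.restrict (Ioo c d)) :=
        (hψ'.integrable one_le_two).sub (integrable_const _)
      have hmi : Integrable (fun t => (ψ t - m) ^ 2) (volume.restrict (Ioo c d)) :=
        (hψ'.sub (memLp_const m)).integrable_sq
      rw [intervalIntegral.integral_of_le hcd.le, integral_Ioc_eq_integral_Ioo] at hu ⊢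
      -- Recentred at `m`, the middle term integrates to zero.
      have heq : ∀ t, ψ t ^ 2 - 2 * ε * ψ t
          = (ψ t - m) ^ 2 + (2 * (m - ε)) * (ψ t - ε) - ((ε - m) ^ 2 + ε ^ 2) := fun t => by ring
      simp_rw [heq]
      rw [integral_sub (hmi.fun_add (hui.const_mul _)) (integrable_const _),
        integral_add hmi (hui.const_mul _), integral_const_mul, hu]
      simp [hcd.le]
      nlinarith [mul_nonneg (sq_nonneg (ε - m)) (sub_pos.2 hcd).le]
    · intro t _ ht
      nlinarith [h0 t]
  rw [intervalIntegral.integral_of_le hab, integral_Ioc_eq_integral_Ioo,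
    integral_sub hψ.integrable_sq ((hψ.integrable one_le_two).const_mul _),
    integral_const_mul] at key
  linarith

/-- The weight `exp l` turns truncated moments into exponential ones. -/
theorem integral_exp_mul_max_sub (ε : ℝ) {x N : ℝ} (hx : 0 ≤ x) (hxN : x ≤ N) :
    ∫ l in (0 : ℝ)..N, Real.exp l * (max (x - l) 0 ^ 2 - 2 * ε * max (x - l) 0)
      = 2 * (1 - ε) * (Real.exp x - 1 - x) - x ^ 2 := by
  have hc : Continuous fun l : ℝ =>
      Real.exp l * (max (x - l) 0 ^ 2 - 2 * ε * max (x - l) 0) := by fun_prop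
  rw [← intervalIntegral.integral_add_adjacent_intervals (hc.intervalIntegrable 0 x)
    (hc.intervalIntegrable x N)]
  have h1 : ∫ l in (0 : ℝ)..x, Real.exp l * (max (x - l) 0 ^ 2 - 2 * ε * max (x - l) 0)
      = ∫ l in (0 : ℝ)..x, Real.exp l * ((x - l) ^ 2 - 2 * ε * (x - l)) := by
    refine intervalIntegral.integral_congr fun l hl => ?_
    rw [uIcc_of_le hx] at hl
    rw [max_eq_left (sub_nonneg.2 hl.2)]
  have h2 : ∫ l in x..N, Real.exp l * (max (x - l) 0 ^ 2 - 2 * ε * max (x - l) 0) = 0 := by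
    rw [intervalIntegral.integral_congr (g := fun _ => 0), intervalIntegral.integral_zero]
    intro l hl
    rw [uIcc_of_le hxN] at hl
    beta_reduce
    rw [max_eq_right (sub_nonpos.2 hl.1)]
    ring
  have h3 : ∀ l ∈ uIcc 0 x, HasDerivAt
      (fun l => Real.exp l * ((x - l) ^ 2 + 2 * (x - l) + 2 - 2 * ε * (x - l) - 2 * ε))
      (Real.exp l * ((x - l) ^ 2 - 2 * ε * (x - l))) l := by
    intro l _
    have hd : HasDerivAt (fun l : ℝ => x - l) (-1) l := (hasDerivAt_id l).const_sub x
    exact ((Real.hasDerivAt_exp l).mul (((((hd.pow 2).add (hd.const_mul 2)).add_const 2).sub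
      (hd.const_mul (2 * ε))).sub_const (2 * ε))).congr_deriv (by simp; ring)
  rw [h1, h2, intervalIntegral.integral_eq_sub_of_hasDerivAt h3
    (Continuous.intervalIntegrable (by fun_prop) _ _)]
  simp
  ring

/-- The one-sided exponential estimate for a function bounded above, obtained by integrating
`OscLE.integral_sq_le` for the truncations `max (φ - l) 0` against `exp l` over `l`. -/
theorem OscLE.integral_exp_posPart_le {ε : ℝ} (hε : 0 ≤ ε) {φ : ℝ → ℝ} {a b N : ℝ}
    (hab : a ≤ b) (h : OscLE ε φ a b) (hφ : MemLp φ 2 (volume.restrict (Ioo a b)))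
    (hN : ∀ t, φ t ≤ N) (hN0 : 0 ≤ N) (hmean : ∫ t in Ioo a b, max (φ t) 0 ≤ ε * (b - a)) :
    2 * (1 - ε) * ∫ t in Ioo a b, (Real.exp (max (φ t) 0) - 1 - max (φ t) 0)
      ≤ ∫ t in Ioo a b, max (φ t) 0 ^ 2 := by
  have hψ : MemLp (fun t => max (φ t) 0) 2 (volume.restrict (Ioo a b)) := by
    simpa using hφ.lipschitz_comp (lipschitzWith_max_sub 0)
  have hb : ∀ t, max (φ t) 0 ≤ N := fun t => max_le (hN t) hN0
  have hint : Integrable (fun t => Real.exp (max (φ t) 0) - 1 - max (φ t) 0)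
      (volume.restrict (Ioo a b)) := by
    refine (Integrable.sub (Integrable.of_bound
      (Real.continuous_exp.comp_aestronglyMeasurable hψ.1) (Real.exp N) (ae_of_all _ fun t => ?_))
      (integrable_const 1)).sub (hψ.integrable one_le_two)
    rw [Real.norm_eq_abs, Real.abs_exp]
    exact Real.exp_le_exp.2 (hb t)
  let K : ℝ → ℝ → ℝ := fun l t =>
    Real.exp l * (max (max (φ t) 0 - l) 0 ^ 2 - 2 * ε * max (max (φ t) 0 - l) 0)
  have hKle : ∀ l ∈ Ioc 0 N, ∫ t in Ioo a b, K l t ≤ 0 := by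
    intro l hl
    have hmm : ∀ t, max (max (φ t) 0 - l) 0 = max (φ t - l) 0 := by
      intro t
      rcases le_total (φ t) 0 with h | h
      · rw [max_eq_right h, max_eq_right, max_eq_right] <;> linarith [hl.1]
      · rw [max_eq_left h]
    have hl2 := hφ.lipschitz_comp (lipschitzWith_max_sub l)
    have hl' := (h.lipschitz_comp hφ (lipschitzWith_max_sub l)).integral_sq_le hε hab hl2
      (fun t => le_max_right _ _) ((integral_mono (hl2.integrable one_le_two)
        (hψ.integrable one_le_two) fun t =>
          max_le_max_right 0 (sub_le_self _ hl.1.le)).trans hmean)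
    simp only [K, hmm]
    rw [integral_const_mul, integral_sub hl2.integrable_sq
      ((hl2.integrable one_le_two).const_mul _), integral_const_mul]
    exact mul_nonpos_of_nonneg_of_nonpos (Real.exp_pos l).le (by linarith)
  have hKint : Integrable (Function.uncurry K)
      ((volume.restrict (Ioc 0 N)).prod (volume.restrict (Ioo a b))) := by
    have hm : AEStronglyMeasurable (Function.uncurry K)
        ((volume.restrict (Ioc 0 N)).prod (volume.restrict (Ioo a b))) := by
      have hc : Continuous fun z : ℝ × ℝ =>
          Real.exp z.1 * (max (z.2 - z.1) 0 ^ 2 - 2 * ε * max (z.2 - z.1) 0) := by fun_prop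
      exact hc.comp_aestronglyMeasurable
        (aestronglyMeasurable_id.comp_fst.prodMk hψ.1.comp_snd)
    refine Integrable.of_bound hm (Real.exp N * (N ^ 2 + 2 * ε * N)) ?_
    rw [Measure.prod_restrict]
    refine (ae_restrict_iff' (measurableSet_Ioc.prod measurableSet_Ioo)).2
      (ae_of_all _ fun z hz => ?_)
    have hz1 : z.1 ∈ Ioc 0 N := hz.1
    have h1 : 0 ≤ max (max (φ z.2) 0 - z.1) 0 := le_max_right _ _
    have h2 : max (max (φ z.2) 0 - z.1) 0 ≤ N :=
      max_le (by linarith [hb z.2, hz1.1]) hN0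
    simp only [Function.uncurry, K, norm_mul, Real.norm_eq_abs, Real.abs_exp]
    refine mul_le_mul (Real.exp_le_exp.2 hz1.2) ?_ (abs_nonneg _) (Real.exp_pos _).le
    generalize max (max (φ z.2) 0 - z.1) 0 = y at h1 h2
    have hy2 : y ^ 2 ≤ N ^ 2 := pow_le_pow_left₀ h1 h2 2
    have hy3 : 2 * ε * y ≤ 2 * ε * N := by gcongr
    have hy4 : 0 ≤ 2 * ε * y := by positivity
    rw [abs_le]
    constructor <;> nlinarith [sq_nonneg y, sq_nonneg N]
  have hle : ∫ l in Ioc 0 N, ∫ t in Ioo a b, K l t ≤ 0 :=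
    setIntegral_nonpos measurableSet_Ioc hKle
  rw [integral_integral_swap hKint] at hle
  have hinner : ∀ t, ∫ l in Ioc 0 N, K l t
      = 2 * (1 - ε) * (Real.exp (max (φ t) 0) - 1 - max (φ t) 0) - max (φ t) 0 ^ 2 := by
    intro t
    rw [← intervalIntegral.integral_of_le hN0]
    exact integral_exp_mul_max_sub ε (le_max_right _ _) (hb t)
  simp_rw [hinner] at hle
  rw [integral_sub (hint.const_mul _) hψ.integrable_sq, integral_const_mul] at hle
  linarith

/-- The mean of `|φ|` is at most its quadratic mean. -/
theorem integral_abs_le_of_integral_sq_le {ε : ℝ} (hε : 0 ≤ ε) {φ : ℝ → ℝ} {a b : ℝ} (hab : a < b)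
    (hφ : MemLp φ 2 (volume.restrict (Ioo a b)))
    (h2 : ∫ t in Ioo a b, φ t ^ 2 ≤ ε ^ 2 * (b - a)) :
    ∫ t in Ioo a b, |φ t| ≤ ε * (b - a) := by
  have hba : 0 < b - a := sub_pos.2 hab
  set I := ∫ t in Ioo a b, |φ t| with hI
  have hi : Integrable (fun t => |φ t|) (volume.restrict (Ioo a b)) :=
    (hφ.integrable one_le_two).abs
  have h0 : 0 ≤ ∫ t in Ioo a b, (|φ t| - I / (b - a)) ^ 2 :=
    integral_nonneg fun t => sq_nonneg _
  have heq : ∀ t, (|φ t| - I / (b - a)) ^ 2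
      = φ t ^ 2 - 2 * (I / (b - a)) * |φ t| + (I / (b - a)) ^ 2 := by
    intro t
    rw [sub_sq, sq_abs]
    ring
  simp_rw [heq] at h0
  have hi' : Integrable (fun t => φ t ^ 2 - 2 * (I / (b - a)) * |φ t|)
      (volume.restrict (Ioo a b)) := hφ.integrable_sq.sub (hi.const_mul _)
  rw [integral_add hi' (integrable_const _),
    integral_sub hφ.integrable_sq (hi.const_mul _), integral_const_mul, ← hI] at h0
  simp [hab.le] at h0
  have h3 : I ^ 2 ≤ (ε * (b - a)) ^ 2 := by
    have : (b - a) * (I / (b - a)) ^ 2 = I ^ 2 / (b - a) := by field_simp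
    have h4 : 2 * (I / (b - a)) * I = 2 * (I ^ 2 / (b - a)) := by field_simp
    rw [this, h4] at h0
    have h5 : I ^ 2 / (b - a) ≤ ε ^ 2 * (b - a) := by linarith
    rw [div_le_iff₀ hba] at h5
    linarith
  exact abs_le_of_sq_le_sq' h3 (by positivity) |>.2

/-- The exponential estimate for bounded functions. -/
theorem OscLE.integral_exp_abs_le_of_bounded {ε : ℝ} (hε : 0 ≤ ε) (hε1 : ε < 1) {φ : ℝ → ℝ}
    {a b N : ℝ} (hab : a < b) (h : OscLE ε φ a b) (hφ : MemLp φ 2 (volume.restrict (Ioo a b)))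
    (hN : ∀ t, |φ t| ≤ N) (h2 : ∫ t in Ioo a b, φ t ^ 2 ≤ ε ^ 2 * (b - a)) :
    Integrable (fun t => Real.exp |φ t|) (volume.restrict (Ioo a b)) ∧
    ∫ t in Ioo a b, Real.exp |φ t| ≤ (b - a) * ((1 - ε ^ 2 / 2) / (1 - ε)) := by
  have hba : 0 < b - a := sub_pos.2 hab
  have hN0 : 0 ≤ N := (abs_nonneg _).trans (hN a)
  have hexp : Integrable (fun t => Real.exp |φ t|) (volume.restrict (Ioo a b)) := by
    refine Integrable.of_bound (Real.continuous_exp.comp_aestronglyMeasurable hφ.abs.1)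
      (Real.exp N) (ae_of_all _ fun t => ?_)
    rw [Real.norm_eq_abs, Real.abs_exp]
    exact Real.exp_le_exp.2 (hN t)
  refine ⟨hexp, ?_⟩
  have habs := integral_abs_le_of_integral_sq_le hε hab hφ h2
  have hi : Integrable (fun t => |φ t|) (volume.restrict (Ioo a b)) :=
    (hφ.integrable one_le_two).abs
  have one_side : ∀ {χ : ℝ → ℝ}, OscLE ε χ a b → MemLp χ 2 (volume.restrict (Ioo a b)) →
      (∀ t, |χ t| = |φ t|) →
      MemLp (fun t => max (χ t) 0) 2 (volume.restrict (Ioo a b)) ∧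
      Integrable (fun t => Real.exp (max (χ t) 0) - 1 - max (χ t) 0)
        (volume.restrict (Ioo a b)) ∧
      2 * (1 - ε) * ∫ t in Ioo a b, (Real.exp (max (χ t) 0) - 1 - max (χ t) 0)
        ≤ ∫ t in Ioo a b, max (χ t) 0 ^ 2 := by
    intro χ hχ hχ2 habsχ
    have hm : MemLp (fun t => max (χ t) 0) 2 (volume.restrict (Ioo a b)) := by
      simpa using hχ2.lipschitz_comp (lipschitzWith_max_sub 0)
    have hle : ∀ t, max (χ t) 0 ≤ |φ t| := fun t => by
      rw [← habsχ t]
      exact max_le (le_abs_self _) (abs_nonneg _)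
    refine ⟨hm, ?_, hχ.integral_exp_posPart_le hε hab.le hχ2
      (fun t => (le_abs_self _).trans ((habsχ t).le.trans (hN t))) hN0
      ((integral_mono (hm.integrable one_le_two) hi hle).trans habs)⟩
    refine ((hexp.mono' (Real.continuous_exp.comp_aestronglyMeasurable hm.1)
      (ae_of_all _ fun t => ?_)).sub (integrable_const 1)).sub (hm.integrable one_le_two)
    rw [Real.norm_eq_abs, Real.abs_exp]
    exact Real.exp_le_exp.2 (hle t)
  obtain ⟨hp2, hpi, hp⟩ := one_side h hφ fun _ => rfl
  have hnegL : LipschitzWith 1 fun x : ℝ => -x := LipschitzWith.id.neg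
  obtain ⟨hn2, hni, hn⟩ := one_side (h.lipschitz_comp hφ hnegL) hφ.neg fun t => abs_neg _
  have hsq : ∀ t, φ t ^ 2 = max (φ t) 0 ^ 2 + max (-φ t) 0 ^ 2 := by
    intro t
    rcases le_total (φ t) 0 with h | h
    · rw [max_eq_right h, max_eq_left (by linarith)]; ring
    · rw [max_eq_left h, max_eq_right (by linarith)]; ring
  have he : ∀ t, Real.exp |φ t| = (Real.exp (max (φ t) 0) - 1 - max (φ t) 0)
      + (Real.exp (max (-φ t) 0) - 1 - max (-φ t) 0) + |φ t| + 1 := by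
    intro t
    rcases le_total (φ t) 0 with h | h
    · rw [max_eq_right h, max_eq_left (by linarith), abs_of_nonpos h]
      simp
    · rw [max_eq_left h, max_eq_right (by linarith), abs_of_nonneg h]
      simp
  -- The positive and negative parts share the second moment of `φ`.
  simp_rw [hsq] at h2
  rw [integral_add hp2.integrable_sq hn2.integrable_sq] at h2
  simp_rw [he]
  rw [integral_add ((hpi.fun_add hni).fun_add hi) (integrable_const _),
    integral_add (hpi.fun_add hni) hi,
    integral_add hpi hni]
  simp [hab.le]
  set A := ∫ t in Ioo a b, (Real.exp (max (φ t) 0) - 1 - max (φ t) 0)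
  set B := ∫ t in Ioo a b, (Real.exp (max (-φ t) 0) - 1 - max (-φ t) 0)
  have hAB : A + B ≤ ε ^ 2 * (b - a) / (2 * (1 - ε)) := by
    rw [le_div_iff₀ (by linarith)]
    linarith
  have : (b - a) * ((1 - ε ^ 2 / 2) / (1 - ε))
      = ε ^ 2 * (b - a) / (2 * (1 - ε)) + ε * (b - a) + (b - a) := by
    have : 1 - ε ≠ 0 := by linarith
    field_simp
    ring
  linarith

/-- The exponential estimate: the bounded case applied to the truncations of `φ`. -/
theorem OscLE.lintegral_exp_abs_le {ε : ℝ} (hε : 0 ≤ ε) (hε1 : ε < 1) {φ : ℝ → ℝ}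
    {a b : ℝ} (hab : a < b) (h : OscLE ε φ a b) (hφ : MemLp φ 2 (volume.restrict (Ioo a b)))
    (h2 : ∫ t in Ioo a b, φ t ^ 2 ≤ ε ^ 2 * (b - a)) :
    ∫⁻ t in Ioo a b, ENNReal.ofReal (Real.exp |φ t|)
      ≤ ENNReal.ofReal ((b - a) * ((1 - ε ^ 2 / 2) / (1 - ε))) := by
  let φN : ℕ → ℝ → ℝ := fun N t => max (-(N : ℝ)) (min (φ t) N)
  have habs : ∀ N t, |φN N t| = min |φ t| N := by
    intro N t
    have hN : (0 : ℝ) ≤ N := N.cast_nonneg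
    simp only [φN]
    rcases le_total (φ t) 0 with h | h
    · rw [min_eq_left (h.trans hN), abs_of_nonpos (max_le (by linarith) h), abs_of_nonpos h,
        ← min_neg_neg, neg_neg, min_comm]
    · rw [max_eq_right (le_min (by linarith) (by linarith)), abs_of_nonneg (le_min h hN),
        abs_of_nonneg h]
  have hmem : ∀ N, MemLp (φN N) 2 (volume.restrict (Ioo a b)) :=
    fun N => hφ.lipschitz_comp (lipschitzWith_clamp N)
  have hbd : ∀ N : ℕ, ∫⁻ t in Ioo a b, ENNReal.ofReal (Real.exp |φN N t|)
      ≤ ENNReal.ofReal ((b - a) * ((1 - ε ^ 2 / 2) / (1 - ε))) := by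
    intro N
    obtain ⟨hi, hle⟩ := (h.lipschitz_comp hφ (lipschitzWith_clamp N)).integral_exp_abs_le_of_bounded
      hε hε1 hab (hmem N) (N := N) (fun t => by
        have := habs N t
        simp only [φN] at this
        rw [this]
        exact min_le_right _ _)
      (le_trans (integral_mono (hmem N).integrable_sq hφ.integrable_sq fun t => by
        have := habs N t
        exact sq_le_sq.2 (this.trans_le (min_le_left _ _))) h2)
    rw [← ofReal_integral_eq_lintegral_ofReal hi (ae_of_all _ fun t => (Real.exp_pos _).le)]
    exact ENNReal.ofReal_le_ofReal hle
  refine le_of_tendsto' (lintegral_tendsto_of_tendsto_of_monotone (fun N => ?_)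
    (ae_of_all _ fun t => ?_) (ae_of_all _ fun t => ?_)) hbd
  · exact (Real.continuous_exp.comp_aestronglyMeasurable (hmem N).abs.1).aemeasurable.ennreal_ofReal
  · intro M N hMN
    simp only [habs]
    gcongr
  · refine tendsto_const_nhds.congr' ?_
    filter_upwards [Filter.eventually_ge_atTop ⌈|φ t|⌉₊] with N hN
    rw [habs, min_eq_left (Nat.ceil_le.1 hN)]

/-! ### The BMO norm and square integrability -/

/-- The oscillation about the mean is at most the oscillation about any constant. -/
theorem setIntegral_sub_average_sq_le {φ : ℝ → ℝ} {c d : ℝ} (hcd : c < d)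
    (hφ : MemLp φ 2 (volume.restrict (Ioo c d))) (m : ℝ) :
    ∫ t in Ioo c d, (φ t - ⨍ s in Ioo c d, φ s) ^ 2 ≤ ∫ t in Ioo c d, (φ t - m) ^ 2 := by
  have hdc : 0 < d - c := sub_pos.2 hcd
  set A := ⨍ s in Ioo c d, φ s with hA
  have hAi : ∫ t in Ioo c d, φ t = A * (d - c) := by
    rw [hA, setAverage_eq]
    simp [hcd.le]
    field_simp
  have hi := hφ.integrable one_le_two
  have hAm : Integrable (fun t => (φ t - A) ^ 2) (volume.restrict (Ioo c d)) :=
    (hφ.sub (memLp_const A)).integrable_sq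
  have hlin : Integrable (fun t => 2 * (A - m) * (φ t - A)) (volume.restrict (Ioo c d)) :=
    (hi.sub (integrable_const A)).const_mul _
  have heq : ∀ t, (φ t - m) ^ 2 = (φ t - A) ^ 2 + 2 * (A - m) * (φ t - A) + (A - m) ^ 2 :=
    fun t => by ring
  simp_rw [heq]
  rw [integral_add (hAm.fun_add hlin) (integrable_const _), integral_add hAm hlin,
    integral_const_mul, integral_sub hi (integrable_const A), hAi]
  simp [hcd.le]
  nlinarith [mul_nonneg hdc.le (sq_nonneg (A - m))]

theorem sqOscillation_eq_ofReal {φ : ℝ → ℝ} {c d : ℝ} (hcd : c < d)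
    (hφ : MemLp φ 2 (volume.restrict (Ioo c d))) :
    sqOscillation φ (Ioo c d)
      = ENNReal.ofReal ((∫ t in Ioo c d, (φ t - ⨍ s in Ioo c d, φ s) ^ 2) / (d - c)) := by
  have hsq : Integrable (fun t => (φ t - ⨍ s in Ioo c d, φ s) ^ 2) (volume.restrict (Ioo c d)) :=
    (hφ.sub (memLp_const _)).integrable_sq
  rw [sqOscillation, Real.volume_Ioo, ← ofReal_integral_eq_lintegral_ofReal hsq
    (ae_of_all _ fun t => sq_nonneg _),
    ENNReal.ofReal_div_of_pos (sub_pos.2 hcd)]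

theorem sqOscillation_le_of_integral_le {φ : ℝ → ℝ} {c d K m : ℝ} (hcd : c < d)
    (hφ : MemLp φ 2 (volume.restrict (Ioo c d)))
    (h : ∫ t in Ioo c d, (φ t - m) ^ 2 ≤ K * (d - c)) :
    sqOscillation φ (Ioo c d) ≤ ENNReal.ofReal K := by
  rw [sqOscillation_eq_ofReal hcd hφ]
  refine ENNReal.ofReal_le_ofReal ?_
  rw [div_le_iff₀ (sub_pos.2 hcd)]
  exact (setIntegral_sub_average_sq_le hcd hφ m).trans h

theorem memLp_two_and_integral_le_of_sqOscillation_le {φ : ℝ → ℝ} {c d K : ℝ} (hcd : c < d)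
    (hK : 0 ≤ K) (hφ : IntegrableOn φ (Ioo c d))
    (h : sqOscillation φ (Ioo c d) ≤ ENNReal.ofReal K) :
    MemLp φ 2 (volume.restrict (Ioo c d)) ∧
      ∫ t in Ioo c d, (φ t - ⨍ s in Ioo c d, φ s) ^ 2 ≤ K * (d - c) := by
  have hdc : 0 < d - c := sub_pos.2 hcd
  set A := ⨍ s in Ioo c d, φ s with hA
  have hle : ∫⁻ t in Ioo c d, ENNReal.ofReal ((φ t - A) ^ 2) ≤ ENNReal.ofReal (K * (d - c)) := by
    rw [sqOscillation, Real.volume_Ioo, ENNReal.div_le_iff (by simpa using hcd)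
      ENNReal.ofReal_ne_top, ← ENNReal.ofReal_mul hK] at h
    exact h
  have hmeas : AEStronglyMeasurable (fun t => φ t - A) (volume.restrict (Ioo c d)) :=
    hφ.aestronglyMeasurable.sub aestronglyMeasurable_const
  have hsq : Integrable (fun t => (φ t - A) ^ 2) (volume.restrict (Ioo c d)) := by
    refine ⟨hmeas.pow 2, ?_⟩
    rw [hasFiniteIntegral_iff_ofReal (ae_of_all _ fun t => sq_nonneg _)]
    exact hle.trans_lt ENNReal.ofReal_lt_top
  constructor
  · refine (((memLp_two_iff_integrable_sq hmeas).2 hsq).add (memLp_const A)).ae_eq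
      (ae_of_all _ fun t => ?_)
    simp
  · rw [← ofReal_integral_eq_lintegral_ofReal hsq (ae_of_all _ fun t => sq_nonneg _)] at hle
    exact (ENNReal.ofReal_le_ofReal_iff (by positivity)).1 hle

theorem rpow_half_le_ofReal_iff {x : ℝ≥0∞} {ε : ℝ} (hε : 0 ≤ ε) :
    x ^ (1 / 2 : ℝ) ≤ ENNReal.ofReal ε ↔ x ≤ ENNReal.ofReal (ε ^ 2) := by
  rw [one_div, ENNReal.rpow_inv_le_iff two_pos, ENNReal.ofReal_pow hε, ENNReal.rpow_two]

theorem bmoNorm_le_ofReal_iff {φ : ℝ → ℝ} {Q : Set ℝ} {ε : ℝ} (hε : 0 ≤ ε) :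
    bmoNorm φ Q ≤ ENNReal.ofReal ε ↔
      ∀ c d, c < d → Ioo c d ⊆ Q → sqOscillation φ (Ioo c d) ≤ ENNReal.ofReal (ε ^ 2) := by
  simp only [bmoNorm, iSup_le_iff, rpow_half_le_ofReal_iff hε]

/-- A function of BMO norm at most `ε` is square integrable, and its mean square oscillations are
at most `ε ^ 2`. -/
theorem oscLE_of_bmoNorm_le {φ : ℝ → ℝ} {a b ε : ℝ} (hε : 0 ≤ ε) (hab : a < b)
    (hφ : IntegrableOn φ (Ioo a b)) (h : bmoNorm φ (Ioo a b) ≤ ENNReal.ofReal ε) :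
    MemLp φ 2 (volume.restrict (Ioo a b)) ∧ OscLE ε φ a b := by
  rw [bmoNorm_le_ofReal_iff hε] at h
  refine ⟨(memLp_two_and_integral_le_of_sqOscillation_le hab (sq_nonneg ε) hφ
    (h a b hab Subset.rfl)).1, fun c d hc hcd hd => ⟨_,
    (memLp_two_and_integral_le_of_sqOscillation_le hcd (sq_nonneg ε)
      (hφ.mono_set (Ioo_subset_Ioo hc hd)) (h c d hcd (Ioo_subset_Ioo hc hd))).2⟩⟩

theorem bmoNorm_le_of_oscLE {φ : ℝ → ℝ} {a b ε : ℝ} (hε : 0 ≤ ε)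
    (hφ : MemLp φ 2 (volume.restrict (Ioo a b))) (h : OscLE ε φ a b) :
    bmoNorm φ (Ioo a b) ≤ ENNReal.ofReal ε := by
  rw [bmoNorm_le_ofReal_iff hε]
  intro c d hcd hsub
  obtain ⟨hc, hd⟩ := (Ioo_subset_Ioo_iff hcd).1 hsub
  obtain ⟨m, hm⟩ := h c d hc hcd hd
  exact sqOscillation_le_of_integral_le hcd (hφ.restrict_Ioo hc hd) hm

/-- The upper bound for the exponential average. -/
theorem expAverage_le_of_bmoNorm_le {φ : ℝ → ℝ} {a b ε : ℝ} (hε : 0 ≤ ε) (hε1 : ε < 1)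
    (hab : a < b) (hφ : IntegrableOn φ (Ioo a b)) (h : bmoNorm φ (Ioo a b) ≤ ENNReal.ofReal ε) :
    expAverage φ (Ioo a b) ≤ ENNReal.ofReal ((1 - ε ^ 2 / 2) / (1 - ε)) := by
  obtain ⟨hφ2, hosc⟩ := oscLE_of_bmoNorm_le hε hab hφ h
  set A := ⨍ s in Ioo a b, φ s with hA
  have hL : LipschitzWith 1 fun x : ℝ => x - A :=
    LipschitzWith.of_dist_le_mul fun x y => by simp
  have hsq := (memLp_two_and_integral_le_of_sqOscillation_le hab (sq_nonneg ε) hφ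
    ((bmoNorm_le_ofReal_iff hε).1 h a b hab Subset.rfl)).2
  have := (hosc.lipschitz_comp hφ2 hL).lintegral_exp_abs_le hε hε1 hab (hφ2.lipschitz_comp hL) hsq
  rw [expAverage, Real.volume_Ioo, ENNReal.div_le_iff (by simpa using hab) ENNReal.ofReal_ne_top,
    mul_comm, ← ENNReal.ofReal_mul (sub_pos.2 hab).le]
  exact this

/-! ### Extremal functions -/

theorem continuousOn_mul_log_sq : ContinuousOn (fun t : ℝ => t * Real.log t ^ 2) (Ici 0) := by
  have hc : Continuous fun t : ℝ => 4 * (√t * Real.log √t) ^ 2 :=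
    continuous_const.mul ((Real.continuous_mul_log.comp Real.continuous_sqrt).pow 2)
  refine hc.continuousOn.congr fun t ht => ?_
  have ht : 0 ≤ t := ht
  beta_reduce
  rw [Real.log_sqrt ht, mul_pow, Real.sq_sqrt ht]
  ring

/-- The second moment of `-log` about `m`, on an interval that may start at the singularity: the
primitive is continuous at `0`, with the convention `Real.log 0 = 0`. -/
theorem integral_neg_log_sub_sq {c d : ℝ} (hc : 0 ≤ c) (hcd : c ≤ d) (m : ℝ) :
    IntervalIntegrable (fun t => (-Real.log t - m) ^ 2) volume c d ∧
    ∫ t in c..d, (-Real.log t - m) ^ 2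
      = (d * Real.log d ^ 2 - 2 * (d * Real.log d) + 2 * d
          + 2 * m * (d * Real.log d - d) + m ^ 2 * d)
        - (c * Real.log c ^ 2 - 2 * (c * Real.log c) + 2 * c
          + 2 * m * (c * Real.log c - c) + m ^ 2 * c) := by
  let G : ℝ → ℝ := fun t => t * Real.log t ^ 2 - 2 * (t * Real.log t) + 2 * t
    + 2 * m * (t * Real.log t - t) + m ^ 2 * t
  have hG : ContinuousOn G (Icc c d) := by
    have h1 := continuousOn_mul_log_sq.mono (fun t ht => hc.trans ht.1 : Icc c d ⊆ Ici 0)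
    have h2 : ContinuousOn (fun t : ℝ => t * Real.log t) (Icc c d) :=
      Real.continuous_mul_log.continuousOn
    exact (((h1.sub (h2.const_mul 2)).add (continuousOn_id.const_mul 2)).add
      ((h2.sub continuousOn_id).const_mul (2 * m))).add (continuousOn_id.const_mul (m ^ 2))
  have hG' : ∀ t ∈ Ioo c d, HasDerivAt G ((-Real.log t - m) ^ 2) t := by
    intro t ht
    have ht0 : t ≠ 0 := (hc.trans_lt ht.1).ne'
    have hl := Real.hasDerivAt_log ht0
    have hid := hasDerivAt_id t
    have hml := hid.mul hl
    exact ((((hid.mul (hl.pow 2)).sub (hml.const_mul 2)).add (hid.const_mul 2)).add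
      ((hml.sub hid).const_mul (2 * m))).add (hid.const_mul (m ^ 2)) |>.congr_deriv (by
        simp
        field_simp
        ring)
  have hint : IntervalIntegrable (fun t => (-Real.log t - m) ^ 2) volume c d := by
    rw [intervalIntegrable_iff_integrableOn_Ioc_of_le hcd]
    exact intervalIntegral.integrableOn_deriv_of_nonneg hG hG' fun t _ => sq_nonneg _
  exact ⟨hint, intervalIntegral.integral_eq_sub_of_hasDerivAt_of_le hcd hG hG' hint⟩

/-- The function `log` has mean square oscillation at most `1` on every interval `(c, d)` with
`0 ≤ c`: the oscillation is `1 - c * d * (log d - log c) ^ 2 / (d - c) ^ 2`. -/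
theorem exists_integral_neg_log_sub_sq_le {c d : ℝ} (hc : 0 ≤ c) (hcd : c < d) :
    ∃ m, ∫ t in c..d, (-Real.log t - m) ^ 2 ≤ d - c := by
  have hdc : 0 < d - c := sub_pos.2 hcd
  have hne : d - c ≠ 0 := hdc.ne'
  -- The constant is the mean of `-log` on `(c, d)`.
  refine ⟨-((d * Real.log d - d - (c * Real.log c - c)) / (d - c)), ?_⟩
  rw [(integral_neg_log_sub_sq hc hcd.le _).2]
  generalize Real.log d = x
  generalize Real.log c = y
  have key : d - c - ((d * x ^ 2 - 2 * (d * x) + 2 * d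
          + 2 * (-((d * x - d - (c * y - c)) / (d - c))) * (d * x - d)
          + (-((d * x - d - (c * y - c)) / (d - c))) ^ 2 * d)
        - (c * y ^ 2 - 2 * (c * y) + 2 * c
          + 2 * (-((d * x - d - (c * y - c)) / (d - c))) * (c * y - c)
          + (-((d * x - d - (c * y - c)) / (d - c))) ^ 2 * c))
      = c * d * (x - y) ^ 2 / (d - c) := by
    field_simp
    ring
  have : 0 ≤ c * d * (x - y) ^ 2 / (d - c) := by
    have := hc.trans hcd.le
    positivity
  linarith

/-- The positive part of `-log`. -/
noncomputable def logSpike (t : ℝ) : ℝ := max (-Real.log t) 0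

theorem logSpike_of_le_one {t : ℝ} (h0 : 0 ≤ t) (h1 : t ≤ 1) : logSpike t = -Real.log t :=
  max_eq_left (neg_nonneg.2 (Real.log_nonpos h0 h1))

theorem logSpike_of_one_le {t : ℝ} (h1 : 1 ≤ t) : logSpike t = 0 :=
  max_eq_right (neg_nonpos.2 (Real.log_nonneg h1))

theorem logSpike_nonneg (t : ℝ) : 0 ≤ logSpike t := le_max_right _ _

/-- The extremal function on `(0, 4)`: a logarithmic spike of height `ε * log (1 / t)` on `(0, 1)`,
its negative mirror image on `(3, 4)`, and zero in between. -/
noncomputable def doubleSpike (ε t : ℝ) : ℝ := ε * (logSpike t - logSpike (4 - t))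

theorem measurable_logSpike : Measurable logSpike := by
  unfold logSpike
  fun_prop

theorem setIntegral_Ioo_comp_const_sub (g : ℝ → ℝ) {c d : ℝ} (hcd : c ≤ d) (e : ℝ) :
    ∫ t in Ioo c d, g (e - t) = ∫ t in Ioo (e - d) (e - c), g t := by
  rw [← integral_Ioc_eq_integral_Ioo, ← integral_Ioc_eq_integral_Ioo,
    ← intervalIntegral.integral_of_le hcd, ← intervalIntegral.integral_of_le (by linarith),
    intervalIntegral.integral_comp_sub_left]

theorem integrableOn_comp_const_sub {g : ℝ → ℝ} {e : ℝ} (he : 0 ≤ e)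
    (hg : IntegrableOn g (Ioo 0 e)) : IntegrableOn (fun t => g (e - t)) (Ioo 0 e) := by
  rw [← intervalIntegrable_iff_integrableOn_Ioo_of_le he] at hg ⊢
  simpa using (hg.comp_sub_left e).symm

theorem memLp_logSpike : MemLp logSpike 2 (volume.restrict (Ioo 0 4)) := by
  refine (memLp_two_iff_integrable_sq measurable_logSpike.aestronglyMeasurable).2 ?_
  have := (integral_neg_log_sub_sq le_rfl (by norm_num : (0 : ℝ) ≤ 4) 0).1
  rw [intervalIntegrable_iff_integrableOn_Ioo_of_le (by norm_num)] at this
  refine this.mono' (measurable_logSpike.pow_const 2).aestronglyMeasurable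
    (ae_of_all _ fun t => ?_)
  rw [Real.norm_eq_abs, abs_sq, sub_zero, logSpike]
  refine sq_le_sq.2 ?_
  rw [abs_of_nonneg (le_max_right _ _)]
  exact max_le (le_abs_self _) (abs_nonneg _)

theorem memLp_logSpike_comp : MemLp (fun t => logSpike (4 - t)) 2 (volume.restrict (Ioo 0 4)) :=
  (memLp_two_iff_integrable_sq (measurable_logSpike.comp
    (measurable_const.sub measurable_id)).aestronglyMeasurable).2
    (integrableOn_comp_const_sub (g := fun t => logSpike t ^ 2) (by norm_num)
      memLp_logSpike.integrable_sq)

theorem memLp_doubleSpike (ε : ℝ) : MemLp (doubleSpike ε) 2 (volume.restrict (Ioo 0 4)) :=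
  (memLp_logSpike.sub memLp_logSpike_comp).const_mul ε

theorem exists_setIntegral_logSpike_sub_sq_le {c d : ℝ} (hc : 0 ≤ c) (hcd : c < d) (hd : d ≤ 4) :
    ∃ m, ∫ t in Ioo c d, (logSpike t - m) ^ 2 ≤ d - c := by
  obtain ⟨m, hm⟩ := exists_integral_neg_log_sub_sq_le hc hcd
  refine ⟨max m 0, le_trans ?_ hm⟩
  rw [intervalIntegral.integral_of_le hcd.le, integral_Ioc_eq_integral_Ioo]
  refine integral_mono ((memLp_logSpike.restrict_Ioo hc hd).sub (memLp_const _)).integrable_sq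
    ((intervalIntegrable_iff_integrableOn_Ioo_of_le hcd.le).1
      (integral_neg_log_sub_sq hc hcd.le m).1) fun t => ?_
  exact sq_le_sq.2 (abs_max_sub_max_le_abs _ _ _)

theorem setIntegral_logSpike_sq {c d : ℝ} (hc : 0 ≤ c) (hc1 : c ≤ 1) (hd1 : 1 ≤ d) (hd : d ≤ 4) :
    ∫ t in Ioo c d, logSpike t ^ 2
      = 2 - c * (Real.log c ^ 2 - 2 * Real.log c + 2) := by
  have hcd := hc1.trans hd1
  have hi : ∀ {x y : ℝ}, 0 ≤ x → x ≤ y → y ≤ 4 →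
      IntervalIntegrable (fun t => logSpike t ^ 2) volume x y := fun hx hxy hy =>
    (intervalIntegrable_iff_integrableOn_Ioo_of_le hxy).2
      (memLp_logSpike.restrict_Ioo hx hy).integrable_sq
  rw [← integral_Ioc_eq_integral_Ioo, ← intervalIntegral.integral_of_le hcd,
    ← intervalIntegral.integral_add_adjacent_intervals (hi hc hc1 (hd1.trans hd))
      (hi zero_le_one hd1 hd)]
  have h1 : ∫ t in c..1, logSpike t ^ 2 = ∫ t in c..1, (-Real.log t - 0) ^ 2 := by
    refine intervalIntegral.integral_congr fun t ht => ?_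
    rw [uIcc_of_le hc1] at ht
    rw [logSpike_of_le_one (hc.trans ht.1) ht.2, sub_zero]
  have h2 : ∫ t in (1 : ℝ)..d, logSpike t ^ 2 = 0 := by
    rw [intervalIntegral.integral_congr (g := fun _ => 0), intervalIntegral.integral_zero]
    intro t ht
    rw [uIcc_of_le hd1] at ht
    beta_reduce
    rw [logSpike_of_one_le ht.1]
    simp
  rw [h1, h2, (integral_neg_log_sub_sq hc hc1 0).2]
  simp
  ring

theorem setIntegral_logSpike_sq_le {c d : ℝ} (hc : 0 ≤ c) (hc1 : c ≤ 1) (hd1 : 1 ≤ d)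
    (hd : d ≤ 4) : ∫ t in Ioo c d, logSpike t ^ 2 ≤ 2 - c := by
  rw [setIntegral_logSpike_sq hc hc1 hd1 hd]
  nlinarith [mul_nonneg hc (sq_nonneg (Real.log c - 1))]

/-- The two spikes have disjoint supports. -/
theorem logSpike_mul_logSpike (t : ℝ) : logSpike t * logSpike (4 - t) = 0 := by
  rcases le_total 1 t with h | h
  · rw [logSpike_of_one_le h, zero_mul]
  · rw [logSpike_of_one_le (show 1 ≤ 4 - t by linarith), mul_zero]

theorem setIntegral_doubleSpike_sq (ε : ℝ) {c d : ℝ} (hc : 0 ≤ c) (hcd : c ≤ d) (hd : d ≤ 4) :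
    ∫ t in Ioo c d, doubleSpike ε t ^ 2 = ε ^ 2 *
      ((∫ t in Ioo c d, logSpike t ^ 2) + ∫ t in Ioo (4 - d) (4 - c), logSpike t ^ 2) := by
  have heq : ∀ t, doubleSpike ε t ^ 2 = ε ^ 2 * (logSpike t ^ 2 + logSpike (4 - t) ^ 2) := by
    intro t
    rw [doubleSpike]
    linear_combination (-2 * ε ^ 2) * logSpike_mul_logSpike t
  simp_rw [heq]
  rw [integral_const_mul, integral_add (memLp_logSpike.restrict_Ioo hc hd).integrable_sq
    (memLp_logSpike_comp.restrict_Ioo hc hd).integrable_sq,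
    setIntegral_Ioo_comp_const_sub (fun t => logSpike t ^ 2) hcd]

/-- The oscillation of `doubleSpike ε` is at most `ε`. Intervals that meet at most one spike are
covered by the estimate for `log`; the others by the second moment. -/
theorem oscLE_doubleSpike (ε : ℝ) : OscLE ε (doubleSpike ε) 0 4 := by
  intro c d hc hcd hd
  rcases le_total d 3 with hd3 | hd3
  · obtain ⟨m, hm⟩ := exists_setIntegral_logSpike_sub_sq_le hc hcd hd
    refine ⟨ε * m, ?_⟩
    have : ∫ t in Ioo c d, (doubleSpike ε t - ε * m) ^ 2
        = ∫ t in Ioo c d, ε ^ 2 * (logSpike t - m) ^ 2 := by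
      refine setIntegral_congr_fun measurableSet_Ioo fun t ht => ?_
      rw [doubleSpike, logSpike_of_one_le (show 1 ≤ 4 - t by linarith [ht.2])]
      ring
    rw [this, integral_const_mul]
    gcongr
  rcases le_total 1 c with hc1 | hc1
  · obtain ⟨m, hm⟩ := exists_setIntegral_logSpike_sub_sq_le (c := 4 - d) (d := 4 - c)
      (by linarith) (by linarith) (by linarith)
    refine ⟨-(ε * m), ?_⟩
    have : ∫ t in Ioo c d, (doubleSpike ε t - -(ε * m)) ^ 2
        = ∫ t in Ioo c d, ε ^ 2 * (logSpike (4 - t) - m) ^ 2 := by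
      refine setIntegral_congr_fun measurableSet_Ioo fun t ht => ?_
      rw [doubleSpike, logSpike_of_one_le (hc1.trans ht.1.le)]
      ring
    rw [this, integral_const_mul,
      setIntegral_Ioo_comp_const_sub (fun t => (logSpike t - m) ^ 2) hcd.le]
    exact mul_le_mul_of_nonneg_left (by linarith) (sq_nonneg ε)
  · refine ⟨0, ?_⟩
    simp only [sub_zero]
    rw [setIntegral_doubleSpike_sq ε hc hcd.le hd]
    have h1 := setIntegral_logSpike_sq_le hc hc1 (by linarith) hd
    have h2 := setIntegral_logSpike_sq_le (c := 4 - d) (d := 4 - c) (by linarith) (by linarith)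
      (by linarith) (by linarith)
    exact mul_le_mul_of_nonneg_left (by linarith) (sq_nonneg ε)

theorem setAverage_doubleSpike (ε : ℝ) : ⨍ t in Ioo (0 : ℝ) 4, doubleSpike ε t = 0 := by
  rw [setAverage_eq]
  simp only [doubleSpike]
  rw [integral_const_mul, integral_sub (memLp_logSpike.integrable one_le_two)
    (memLp_logSpike_comp.integrable one_le_two),
    setIntegral_Ioo_comp_const_sub logSpike (by norm_num)]
  simp

theorem sqOscillation_doubleSpike (ε : ℝ) :
    sqOscillation (doubleSpike ε) (Ioo 0 4) = ENNReal.ofReal (ε ^ 2) := by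
  rw [sqOscillation_eq_ofReal (by norm_num) (memLp_doubleSpike ε), setAverage_doubleSpike]
  simp only [sub_zero]
  rw [setIntegral_doubleSpike_sq ε le_rfl (by norm_num) le_rfl, sub_self, sub_zero,
    setIntegral_logSpike_sq le_rfl zero_le_one (by norm_num) le_rfl]
  congr 1
  ring

theorem bmoNorm_doubleSpike {ε : ℝ} (hε : 0 ≤ ε) :
    bmoNorm (doubleSpike ε) (Ioo 0 4) = ENNReal.ofReal ε := by
  refine le_antisymm (bmoNorm_le_of_oscLE hε (memLp_doubleSpike ε) (oscLE_doubleSpike ε)) ?_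
  refine le_trans ?_ (le_iSup₂_of_le (0 : ℝ) (4 : ℝ)
    (le_iSup₂_of_le (by norm_num) Subset.rfl le_rfl))
  rw [sqOscillation_doubleSpike, ENNReal.ofReal_pow hε, ← ENNReal.rpow_two, ← ENNReal.rpow_mul]
  norm_num

theorem memBMO_doubleSpike {ε : ℝ} (hε : 0 ≤ ε) : MemBMO (doubleSpike ε) (Ioo 0 4) :=
  ⟨(memLp_doubleSpike ε).integrable one_le_two, by
    rw [bmoNorm_doubleSpike hε]
    exact ENNReal.ofReal_lt_top⟩

theorem exp_abs_doubleSpike {ε : ℝ} (hε : 0 ≤ ε) (t : ℝ) : Real.exp |doubleSpike ε t|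
    = Real.exp (ε * logSpike t) + Real.exp (ε * logSpike (4 - t)) - 1 := by
  rw [doubleSpike, abs_mul, abs_of_nonneg hε]
  rcases le_total 1 t with h | h
  · rw [logSpike_of_one_le h, zero_sub, abs_neg, abs_of_nonneg (logSpike_nonneg _)]
    simp
  · rw [logSpike_of_one_le (show 1 ≤ 4 - t by linarith), sub_zero,
      abs_of_nonneg (logSpike_nonneg _)]
    simp

theorem exp_mul_logSpike (ε : ℝ) {t : ℝ} (h0 : 0 < t) (h1 : t ≤ 1) :
    Real.exp (ε * logSpike t) = t ^ (-ε) := by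
  rw [logSpike_of_le_one h0.le h1, Real.rpow_def_of_pos h0]
  ring_nf

theorem integral_exp_mul_logSpike {ε : ℝ} (hε1 : ε < 1) :
    IntegrableOn (fun t => Real.exp (ε * logSpike t)) (Ioo 0 4) ∧
    ∫ t in Ioo (0 : ℝ) 4, Real.exp (ε * logSpike t) = 1 / (1 - ε) + 3 := by
  have e1 : EqOn (fun t : ℝ => t ^ (-ε)) (fun t => Real.exp (ε * logSpike t)) (uIoc 0 1) := by
    intro t ht
    rw [uIoc_of_le zero_le_one] at ht
    exact (exp_mul_logSpike ε ht.1 ht.2).symm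
  have e2 : EqOn (fun _ : ℝ => (1 : ℝ)) (fun t => Real.exp (ε * logSpike t)) (uIoc 1 4) := by
    intro t ht
    rw [uIoc_of_le (by norm_num)] at ht
    beta_reduce
    rw [logSpike_of_one_le ht.1.le, mul_zero, Real.exp_zero]
  have i1 : IntervalIntegrable (fun t => Real.exp (ε * logSpike t)) volume 0 1 :=
    (intervalIntegral.intervalIntegrable_rpow' (by linarith)).congr e1
  have i2 : IntervalIntegrable (fun t => Real.exp (ε * logSpike t)) volume 1 4 :=
    intervalIntegrable_const.congr e2
  refine ⟨(intervalIntegrable_iff_integrableOn_Ioo_of_le (by norm_num)).1 (i1.trans i2), ?_⟩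
  rw [← integral_Ioc_eq_integral_Ioo, ← intervalIntegral.integral_of_le (by norm_num),
    ← intervalIntegral.integral_add_adjacent_intervals i1 i2,
    ← intervalIntegral.integral_congr_ae (ae_of_all _ e1),
    ← intervalIntegral.integral_congr_ae (ae_of_all _ e2),
    integral_rpow (Or.inl (by linarith))]
  have : -ε + 1 ≠ 0 := by linarith
  rw [Real.zero_rpow this, Real.one_rpow, neg_add_eq_sub]
  simp
  norm_num

theorem expAverage_doubleSpike {ε : ℝ} (hε : 0 ≤ ε) (hε1 : ε < 1) :
    expAverage (doubleSpike ε) (Ioo 0 4) = ENNReal.ofReal ((1 - ε / 2) / (1 - ε)) := by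
  obtain ⟨hi, hval⟩ := integral_exp_mul_logSpike hε1
  have hi' : IntegrableOn (fun t => Real.exp (ε * logSpike (4 - t))) (Ioo 0 4) :=
    integrableOn_comp_const_sub (g := fun t => Real.exp (ε * logSpike t)) (by norm_num) hi
  have hint : IntegrableOn (fun t => Real.exp |doubleSpike ε t|) (Ioo 0 4) := by
    simp_rw [exp_abs_doubleSpike hε]
    exact (hi.add hi').sub (integrable_const 1)
  rw [expAverage, setAverage_doubleSpike]
  simp only [sub_zero]
  rw [← ofReal_integral_eq_lintegral_ofReal hint (ae_of_all _ fun t => (Real.exp_pos _).le),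
    Real.volume_Ioo, ← ENNReal.ofReal_div_of_pos (by norm_num)]
  simp_rw [exp_abs_doubleSpike hε]
  rw [integral_sub (Integrable.fun_add hi hi') (integrable_const 1), integral_add hi hi',
    setIntegral_Ioo_comp_const_sub (fun t => Real.exp (ε * logSpike t)) (by norm_num),
    sub_self, sub_zero, hval]
  congr 1
  have : 1 - ε ≠ 0 := by linarith
  simp
  field_simp
  ring

/-- For `ε = 1` the exponential of the spike is `1 / t`, which is not integrable at `0`. -/
theorem expAverage_doubleSpike_one : expAverage (doubleSpike 1) (Ioo 0 4) = ∞ := by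
  have hinv : ∫⁻ t in Ioo (0 : ℝ) 1, ENNReal.ofReal t⁻¹ = ∞ := by
    by_contra hne
    have hint : IntegrableOn (fun t : ℝ => t⁻¹) (Ioo 0 1) := by
      refine ⟨measurable_inv.aestronglyMeasurable, ?_⟩
      rw [hasFiniteIntegral_iff_ofReal]
      · exact lt_top_iff_ne_top.2 hne
      · filter_upwards [ae_restrict_mem measurableSet_Ioo] with t ht
        exact inv_nonneg.2 ht.1.le
    rw [← intervalIntegrable_iff_integrableOn_Ioo_of_le zero_le_one,
      intervalIntegrable_inv_iff] at hint
    simp at hint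
  have htop : ∫⁻ t in Ioo (0 : ℝ) 4, ENNReal.ofReal (Real.exp |doubleSpike 1 t|) = ∞ := by
    refine top_le_iff.1 (hinv.ge.trans (le_trans (setLIntegral_mono' measurableSet_Ioo
      fun t ht => ENNReal.ofReal_le_ofReal ?_)
      (lintegral_mono_set (Ioo_subset_Ioo_right (by norm_num)))))
    rw [exp_abs_doubleSpike zero_le_one, exp_mul_logSpike 1 ht.1 ht.2.le, Real.rpow_neg_one]
    have := Real.one_le_exp (mul_nonneg zero_le_one (logSpike_nonneg (4 - t)))
    linarith
  rw [expAverage, setAverage_doubleSpike]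
  simp only [sub_zero]
  rw [htop, Real.volume_Ioo, ENNReal.top_div_of_ne_top ENNReal.ofReal_ne_top]

/-! ### Affine changes of variable -/

theorem preimage_affine_Ioo {α : ℝ} (hα : 0 < α) (β c d : ℝ) :
    (fun t => α * t + β) ⁻¹' Ioo (α * c + β) (α * d + β) = Ioo c d := by
  ext t
  simp [hα]

theorem measurableEmbedding_affine {α : ℝ} (hα : 0 < α) (β : ℝ) :
    MeasurableEmbedding fun t : ℝ => α * t + β :=
  (affineHomeomorph α β hα.ne').measurableEmbedding

theorem map_affine_restrict_Ioo {α : ℝ} (hα : 0 < α) (β c d : ℝ) :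
    (volume.restrict (Ioo c d)).map (fun t => α * t + β)
      = ENNReal.ofReal α⁻¹ • volume.restrict (Ioo (α * c + β) (α * d + β)) := by
  rw [← preimage_affine_Ioo hα, ← (measurableEmbedding_affine hα β).restrict_map]
  have : (volume : Measure ℝ).map (fun t => α * t + β) = ENNReal.ofReal α⁻¹ • volume := by
    have hcomp : (fun t : ℝ => α * t + β) = (fun t => t + β) ∘ fun t => α * t := rfl
    rw [hcomp, ← Measure.map_map (by fun_prop) (by fun_prop), Real.map_volume_mul_left hα.ne',
      Measure.map_smul, map_add_right_eq_self, abs_of_pos (inv_pos.2 hα)]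
  rw [this, Measure.restrict_smul]

theorem integrableOn_comp_affine {α : ℝ} (hα : 0 < α) {β c d : ℝ} {φ : ℝ → ℝ}
    (hφ : IntegrableOn φ (Ioo (α * c + β) (α * d + β))) :
    IntegrableOn (fun t => φ (α * t + β)) (Ioo c d) := by
  have := hφ.integrable.smul_measure (c := ENNReal.ofReal α⁻¹) ENNReal.ofReal_ne_top
  rw [← map_affine_restrict_Ioo hα, (measurableEmbedding_affine hα β).integrable_map_iff] at this
  exact this

theorem setAverage_comp_affine {α : ℝ} (hα : 0 < α) (β : ℝ) {c d : ℝ} (hcd : c < d)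
    (φ : ℝ → ℝ) :
    ⨍ t in Ioo c d, φ (α * t + β) = ⨍ t in Ioo (α * c + β) (α * d + β), φ t := by
  have hdc : 0 < d - c := sub_pos.2 hcd
  have hlen : α * d + β - (α * c + β) = α * (d - c) := by ring
  have h : ∫ t in Ioo c d, φ (α * t + β) = α⁻¹ * ∫ t in Ioo (α * c + β) (α * d + β), φ t := by
    rw [← (measurableEmbedding_affine hα β).integral_map, map_affine_restrict_Ioo hα,
      integral_smul_measure, ENNReal.toReal_ofReal (inv_pos.2 hα).le, smul_eq_mul]
  rw [setAverage_eq, setAverage_eq, h, Real.volume_real_Ioo_of_le hcd.le,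
    Real.volume_real_Ioo_of_le (by nlinarith), hlen, smul_eq_mul, smul_eq_mul, mul_inv]
  ring

theorem lintegral_div_volume_comp_affine {α : ℝ} (hα : 0 < α) (β : ℝ) (c d : ℝ)
    (f : ℝ → ℝ≥0∞) : (∫⁻ t in Ioo c d, f (α * t + β)) / volume (Ioo c d)
      = (∫⁻ t in Ioo (α * c + β) (α * d + β), f t) / volume (Ioo (α * c + β) (α * d + β)) := by
  have hlen : α * d + β - (α * c + β) = α * (d - c) := by ring
  have hα0 : ENNReal.ofReal α ≠ 0 := by simpa using hα
  rw [← (measurableEmbedding_affine hα β).lintegral_map, map_affine_restrict_Ioo hα,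
    lintegral_smul_measure, Real.volume_Ioo, Real.volume_Ioo, hlen, ENNReal.ofReal_mul hα.le,
    ENNReal.ofReal_inv_of_pos hα, smul_eq_mul, div_eq_mul_inv, div_eq_mul_inv,
    ENNReal.mul_inv (Or.inl hα0) (Or.inl ENNReal.ofReal_ne_top)]
  ring

theorem sqOscillation_comp_affine {α : ℝ} (hα : 0 < α) (β : ℝ) {c d : ℝ} (hcd : c < d)
    (φ : ℝ → ℝ) : sqOscillation (fun t => φ (α * t + β)) (Ioo c d)
      = sqOscillation φ (Ioo (α * c + β) (α * d + β)) := by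
  rw [sqOscillation, setAverage_comp_affine hα β hcd]
  exact lintegral_div_volume_comp_affine hα β c d fun t =>
    ENNReal.ofReal ((φ t - ⨍ s in Ioo (α * c + β) (α * d + β), φ s) ^ 2)

theorem expAverage_comp_affine {α : ℝ} (hα : 0 < α) (β : ℝ) {c d : ℝ} (hcd : c < d)
    (φ : ℝ → ℝ) : expAverage (fun t => φ (α * t + β)) (Ioo c d)
      = expAverage φ (Ioo (α * c + β) (α * d + β)) := by
  rw [expAverage, setAverage_comp_affine hα β hcd]
  exact lintegral_div_volume_comp_affine hα β c d fun t =>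
    ENNReal.ofReal (Real.exp |φ t - ⨍ s in Ioo (α * c + β) (α * d + β), φ s|)

theorem bmoNorm_comp_affine {α : ℝ} (hα : 0 < α) (β a b : ℝ) (φ : ℝ → ℝ) :
    bmoNorm (fun t => φ (α * t + β)) (Ioo a b) = bmoNorm φ (Ioo (α * a + β) (α * b + β)) := by
  have hsurj : Function.Surjective fun t : ℝ => α * t + β :=
    (affineHomeomorph α β hα.ne').surjective
  have hlt : ∀ {c d : ℝ}, α * c + β < α * d + β ↔ c < d := by simp [hα]
  have hle : ∀ {c d : ℝ}, α * c + β ≤ α * d + β ↔ c ≤ d := by simp [hα]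
  unfold bmoNorm
  symm
  rw [← hsurj.iSup_comp]
  refine iSup_congr fun c => ?_
  rw [← hsurj.iSup_comp]
  refine iSup_congr fun d => ?_
  refine iSup_congr_Prop hlt fun hcd => ?_
  refine iSup_congr_Prop ?_ fun _ => ?_
  · rw [Ioo_subset_Ioo_iff hcd, Ioo_subset_Ioo_iff (hlt.2 hcd), hle, hle]
  · rw [sqOscillation_comp_affine hα β hcd]

/-- Functions on one interval can be transplanted to any other with the same BMO norm and the same
exponential average. -/
theorem exists_transplant {a b a' b' : ℝ} (hab : a < b) (hab' : a' < b') {φ : ℝ → ℝ}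
    (hφ : MemBMO φ (Ioo a' b')) : ∃ ψ : ℝ → ℝ, MemBMO ψ (Ioo a b) ∧
      bmoNorm ψ (Ioo a b) = bmoNorm φ (Ioo a' b') ∧
      expAverage ψ (Ioo a b) = expAverage φ (Ioo a' b') := by
  have hba : b - a ≠ 0 := (sub_pos.2 hab).ne'
  obtain ⟨α, β, hα, rfl, rfl⟩ : ∃ α β : ℝ, 0 < α ∧ a' = α * a + β ∧ b' = α * b + β := by
    refine ⟨(b' - a') / (b - a), a' - (b' - a') / (b - a) * a,
      div_pos (sub_pos.2 hab') (sub_pos.2 hab), by ring, ?_⟩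
    field_simp
    ring
  have hn := bmoNorm_comp_affine hα β a b φ
  exact ⟨fun t => φ (α * t + β), ⟨integrableOn_comp_affine hα hφ.1, hn ▸ hφ.2⟩, hn,
    expAverage_comp_affine hα β hab φ⟩

/-! ### The best constant -/

/-- The best constant at norm `ε`, as a supremum over functions on the interval `(0, 4)`; by affine
invariance the choice of interval does not matter. For `0 ≤ ε < 1` the set is nonempty and bounded
above, so the real supremum is genuine. -/
noncomputable def bestConstant (ε : ℝ) : ℝ :=
  sSup {x | ∃ φ, MemBMO φ (Ioo 0 4) ∧ bmoNorm φ (Ioo 0 4) = ENNReal.ofReal ε ∧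
    x = (expAverage φ (Ioo 0 4)).toReal}

theorem upperBound_nonneg {ε : ℝ} (hε : 0 ≤ ε) (hε1 : ε < 1) :
    0 ≤ (1 - ε ^ 2 / 2) / (1 - ε) :=
  div_nonneg (by nlinarith) (by linarith)

theorem toReal_expAverage_le {φ : ℝ → ℝ} {ε : ℝ} (hε : 0 ≤ ε) (hε1 : ε < 1)
    (hφ : MemBMO φ (Ioo 0 4)) (h : bmoNorm φ (Ioo 0 4) = ENNReal.ofReal ε) :
    (expAverage φ (Ioo 0 4)).toReal ≤ (1 - ε ^ 2 / 2) / (1 - ε) :=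
  ENNReal.toReal_le_of_le_ofReal (upperBound_nonneg hε hε1)
    (expAverage_le_of_bmoNorm_le hε hε1 (by norm_num) hφ.1 h.le)

theorem toReal_expAverage_le_bestConstant {φ : ℝ → ℝ} {ε : ℝ} (hε : 0 ≤ ε) (hε1 : ε < 1)
    (hφ : MemBMO φ (Ioo 0 4)) (h : bmoNorm φ (Ioo 0 4) = ENNReal.ofReal ε) :
    (expAverage φ (Ioo 0 4)).toReal ≤ bestConstant ε := by
  refine le_csSup ⟨(1 - ε ^ 2 / 2) / (1 - ε), ?_⟩ ⟨φ, hφ, h, rfl⟩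
  rintro _ ⟨φ, hφ, h, rfl⟩
  exact toReal_expAverage_le hε hε1 hφ h

theorem bestConstant_le {ε K : ℝ} (hε : 0 ≤ ε)
    (hK : ∀ φ, MemBMO φ (Ioo 0 4) → bmoNorm φ (Ioo 0 4) = ENNReal.ofReal ε →
      (expAverage φ (Ioo 0 4)).toReal ≤ K) : bestConstant ε ≤ K := by
  refine csSup_le ⟨_, doubleSpike ε, memBMO_doubleSpike hε, bmoNorm_doubleSpike hε, rfl⟩ ?_
  rintro _ ⟨φ, hφ, h, rfl⟩
  exact hK φ hφ h

theorem lowerBound_le_bestConstant {ε : ℝ} (hε : 0 ≤ ε) (hε1 : ε < 1) :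
    (1 - ε / 2) / (1 - ε) ≤ bestConstant ε := by
  have := toReal_expAverage_le_bestConstant hε hε1 (memBMO_doubleSpike hε) (bmoNorm_doubleSpike hε)
  rwa [expAverage_doubleSpike hε hε1, ENNReal.toReal_ofReal
    (div_nonneg (by linarith) (by linarith))] at this

theorem expAverage_le_bestConstant {a b : ℝ} (hab : a < b) {φ : ℝ → ℝ}
    (hφ : MemBMO φ (Ioo a b)) (h1 : bmoNorm φ (Ioo a b) < 1) :
    expAverage φ (Ioo a b) ≤ ENNReal.ofReal (bestConstant (bmoNorm φ (Ioo a b)).toReal) := by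
  obtain ⟨ψ, hψ, hn, he⟩ := exists_transplant (a := 0) (b := 4) (by norm_num) hab hφ
  have hε : 0 ≤ (bmoNorm φ (Ioo a b)).toReal := ENNReal.toReal_nonneg
  have hε1 : (bmoNorm φ (Ioo a b)).toReal < 1 := by
    rw [← ENNReal.toReal_one]
    exact (ENNReal.toReal_lt_toReal hφ.2.ne ENNReal.one_ne_top).2 h1
  have hnorm : bmoNorm ψ (Ioo 0 4) = ENNReal.ofReal (bmoNorm φ (Ioo a b)).toReal := by
    rw [hn, ENNReal.ofReal_toReal hφ.2.ne]
  have hfin : expAverage ψ (Ioo 0 4) ≠ ∞ := ne_top_of_le_ne_top ENNReal.ofReal_ne_top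
    (expAverage_le_of_bmoNorm_le hε hε1 (by norm_num) hψ.1 hnorm.le)
  rw [← he, ← ENNReal.ofReal_toReal hfin]
  exact ENNReal.ofReal_le_ofReal (toReal_expAverage_le_bestConstant hε hε1 hψ hnorm)

/-- A bound on one interval bounds the best constant. The extremal function has positive
exponential average, so the bound cannot be negative. -/
theorem bestConstant_le_of_forall {a b : ℝ} (hab : a < b) {ε K : ℝ} (hε : 0 ≤ ε) (hε1 : ε < 1)
    (hK : ∀ φ, MemBMO φ (Ioo a b) → bmoNorm φ (Ioo a b) = ENNReal.ofReal ε →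
      expAverage φ (Ioo a b) ≤ ENNReal.ofReal K) : bestConstant ε ≤ K := by
  have hK' : ∀ φ, MemBMO φ (Ioo 0 4) → bmoNorm φ (Ioo 0 4) = ENNReal.ofReal ε →
      expAverage φ (Ioo 0 4) ≤ ENNReal.ofReal K := by
    intro φ hφ h
    obtain ⟨ψ, hψ, hn, he⟩ := exists_transplant hab (by norm_num) hφ
    exact he ▸ hK ψ hψ (hn.trans h)
  have hK0 : 0 ≤ K := by
    have := hK' _ (memBMO_doubleSpike hε) (bmoNorm_doubleSpike hε)
    rw [expAverage_doubleSpike hε hε1] at this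
    have hpos : 0 < (1 - ε / 2) / (1 - ε) := div_pos (by linarith) (by linarith)
    exact (ENNReal.ofReal_pos.1 ((ENNReal.ofReal_pos.2 hpos).trans_le this)).le
  exact bestConstant_le hε fun φ hφ h => ENNReal.toReal_le_of_le_ofReal hK0 (hK' φ hφ h)

theorem theorem4 :
    ∃ C : ℝ → ℝ,
      -- the inequality, with a constant that depends on the norm of `φ` only
      (∀ a b : ℝ, a < b → ∀ φ : ℝ → ℝ, MemBMO φ (Ioo a b) → bmoNorm φ (Ioo a b) < 1 →
        expAverage φ (Ioo a b) ≤ ENNReal.ofReal (C (bmoNorm φ (Ioo a b)).toReal)) ∧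
      -- `C ε` is the smallest constant for functions of norm `ε`, on every interval
      (∀ a b : ℝ, a < b → ∀ ε : ℝ, 0 ≤ ε → ε < 1 → ∀ K : ℝ,
        (∀ φ : ℝ → ℝ, MemBMO φ (Ioo a b) → bmoNorm φ (Ioo a b) = ENNReal.ofReal ε →
          expAverage φ (Ioo a b) ≤ ENNReal.ofReal K) → C ε ≤ K) ∧
      -- two-sided bounds for the smallest constant
      (∀ ε : ℝ, 0 ≤ ε → ε < 1 →
        (1 - ε / 2) / (1 - ε) ≤ C ε ∧ C ε ≤ (1 - ε ^ 2 / 2) / (1 - ε)) ∧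
      -- the bound `1` on the norm is sharp: at norm `1` no finite constant works
      (∀ a b : ℝ, a < b → ∃ φ : ℝ → ℝ, MemBMO φ (Ioo a b) ∧ bmoNorm φ (Ioo a b) = 1 ∧
        expAverage φ (Ioo a b) = ∞) := by
  refine ⟨bestConstant, fun a b hab φ => expAverage_le_bestConstant hab,
    fun a b hab ε hε hε1 K => bestConstant_le_of_forall hab hε hε1,
    fun ε hε hε1 => ⟨lowerBound_le_bestConstant hε hε1,
      bestConstant_le hε fun φ => toReal_expAverage_le hε hε1⟩, fun a b hab => ?_⟩
  obtain ⟨ψ, hψ, hn, he⟩ :=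
    exists_transplant hab (by norm_num) (memBMO_doubleSpike zero_le_one)
  exact ⟨ψ, hψ, by rw [hn, bmoNorm_doubleSpike zero_le_one, ENNReal.ofReal_one],
    he.trans expAverage_doubleSpike_one⟩
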